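/- All algebras are complex $C^*$-algebras, not necessarily unital. A representation of a $C^*$-algebra $\mathcal{A}$ on a Hilbert space $H$ is a $*$-homomorphism $\mathcal{A} \to \mathcal{B}(H)$ (units need not be preserved); it is irreducible if $\{0\}$ and $H$ are the only closed subspaces of $H$ invariant under its image, and $n$-dimensional if $\dim H = n$. Let $M_n$ be the $C^*$-algebra of complex $n \times n$ matrices; $n$-dimensional representations are identified with $*$-homomorphisms into $M_n$. For finite $n$, a $C^*$-algebra is called $n$-homogeneous if every nonzero irreducible representation of it acts on an $n$-dimensional Hilbert space. Proposition. Let $\mathcal{A}_2$ be an $n$-homogeneous $C^*$-algebra and let $\mathcal{A}_1 \subset \mathcal{A}_2$ be a $C^*$-subalgebra (a norm-closed $*$-subalgebra) which is itself $n$-homogeneous. (a) Every representation $\pi_1 \colon \mathcal{A}_1 \to M_n$ extends to a representation $\pi_2 \colon \mathcal{A}_2 \to M_n$, that is, $\pi_2|_{\mathcal{A}_1} = \pi_1$. (b) If every representation $\mathcal{A}_1 \to M_n$ (including the zero one) has exactly one extension to a representation $\mathcal{A}_2 \to M_n$, then $\mathcal{A}_1 = \mathcal{A}_2$. -/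

import Mathlib

/-- A representation of a C⋆-algebra `A` on a Hilbert space `H` (a ⋆-homomorphism from `A` to the
bounded operators on `H`, not required to be unital or nondegenerate) is irreducible if the only
closed subspaces of `H` invariant under `π a` for all `a : A` are `0` and `H`. -/
def IsIrreducibleRep {A : Type*} [NonUnitalCStarAlgebra A]
    {H : Type*} [NormedAddCommGroup H] [InnerProductSpace ℂ H] [CompleteSpace H]
    (π : A →⋆ₙₐ[ℂ] (H →L[ℂ] H)) : Prop :=
  ∀ K : Submodule ℂ H, IsClosed (K : Set H) → (∀ a : A, ∀ v ∈ K, π a v ∈ K) → K = ⊥ ∨ K = ⊤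

/-- A C⋆-algebra `A` is `n`-homogeneous if each of its nonzero irreducible representations acts on
an `n`-dimensional Hilbert space. Quantifying over Hilbert spaces in the universe of `A` loses
nothing: the space of a nonzero irreducible representation is the closure of `π(A) v` for some
vector `v`, hence isometrically isomorphic to the completion of a quotient of `A`. -/
def IsHomogeneousCStar.{u} (n : ℕ) (A : Type u) [NonUnitalCStarAlgebra A] : Prop :=
  ∀ (H : Type u) [NormedAddCommGroup H] [InnerProductSpace ℂ H] [CompleteSpace H]
    (π : A →⋆ₙₐ[ℂ] (H →L[ℂ] H)), π ≠ 0 → IsIrreducibleRep π →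
      FiniteDimensional ℂ H ∧ Module.finrank ℂ H = n

/-! Put E = ℂⁿ. Under pointwise norm convergence the representations on E, zero included, form a
compact Hausdorff space. Homogeneity supplies two facts. These representations compute the norm
(`IsHomogeneousCStar.exists_norm_le`, from pure states and GNS), and every nonzero one is onto B(E)
(`IsHomogeneousCStar.surjective`). As B(E) is simple with only inner automorphisms, inequivalent
representations are separated by an element, and compactness extends this to compact sets
(`exists_vanishing_on_compact`).

For (a), restrictions from A₂ form a compact set stable under unitary conjugation. A nonzero π₁
outside it gives h in A₁ killed by every restriction with π₁ h = 1; but the restrictions compute the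
norm of h, so h = 0.

For (b), uniqueness says that restriction is injective, and a Stone–Weierstrass argument shows that
A₁ is dense. Near a given representation, an element a of A₂ is matched by some b in A₁ by
surjectivity. The local choices are glued with elements of A₁ that act as scalars in every
representation (`exists_scalar_bump`). Closedness of A₁ finishes. -/

/-! ### Norm-attaining extremal states. -/

section PureState

open scoped InnerProductSpace ComplexOrder

variable {B : Type*} [CStarAlgebra B]

/-- A contractive linear functional with value `1` at the unit is real on self-adjoint elements. -/
lemma im_apply_eq_zero_of_isSelfAdjoint [Nontrivial B] {F : B → ℂ}
    (hadd : ∀ x y, F (x + y) = F x + F y) (hsmul : ∀ (c : ℂ) x, F (c • x) = c * F x)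
    (hF : ∀ x, ‖F x‖ ≤ ‖x‖) (h1 : F 1 = 1) {h : B} (hh : IsSelfAdjoint h) : (F h).im = 0 := by
  -- Test F on h + is: its square norm is at most ‖h‖² + s², while |F h + is|² contains the cross
  -- term 2s Im F h, which must stay bounded in s.
  have key : ∀ s : ℝ, (F h).im * (2 * s) ≤ ‖h‖ ^ 2 := by
    intro s
    have hn : ‖h + ((s : ℂ) * Complex.I) • (1 : B)‖ ^ 2 ≤ ‖h‖ ^ 2 + s ^ 2 := by
      rw [sq, ← CStarRing.norm_star_mul_self]
      have e : star (h + ((s : ℂ) * Complex.I) • (1 : B)) * (h + ((s : ℂ) * Complex.I) • (1 : B))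
          = h * h + ((s ^ 2 : ℝ) : ℂ) • (1 : B) := by
        have hI : ((s ^ 2 : ℝ) : ℂ) = -(((s : ℂ) * Complex.I) * ((s : ℂ) * Complex.I)) := by
          push_cast
          linear_combination ((s : ℂ) ^ 2) * Complex.I_sq
        have hs : star ((s : ℂ) * Complex.I) = -((s : ℂ) * Complex.I) := by simp
        rw [star_add, hh.star_eq, star_smul, star_one, hs, hI]
        simp only [add_mul, mul_add, smul_mul_assoc, mul_smul_comm, one_mul, mul_one]
        module
      rw [e]
      refine (norm_add_le _ _).trans (add_le_add ?_ ?_)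
      · rw [sq]; exact norm_mul_le _ _
      · rw [norm_smul, Complex.norm_real, norm_one, mul_one, Real.norm_of_nonneg (by positivity)]
    have hv := hF (h + ((s : ℂ) * Complex.I) • (1 : B))
    rw [hadd, hsmul, h1, mul_one] at hv
    have h4 : ‖F h + (s : ℂ) * Complex.I‖ ^ 2 ≤ ‖h‖ ^ 2 + s ^ 2 :=
      (pow_le_pow_left₀ (norm_nonneg _) hv 2).trans hn
    rw [Complex.sq_norm, Complex.normSq_apply] at h4
    simp at h4
    nlinarith [sq_nonneg (F h).re, sq_nonneg (F h).im]
  by_contra hne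
  have h5 := key ((‖h‖ ^ 2 + 1) / (2 * (F h).im))
  rw [show (F h).im * (2 * ((‖h‖ ^ 2 + 1) / (2 * (F h).im))) = ‖h‖ ^ 2 + 1 by field_simp] at h5
  linarith

variable [PartialOrder B] [StarOrderedRing B]

/-- A contractive linear functional with value `1` at the unit is positive. -/
lemma nonneg_apply_of_nonneg [Nontrivial B] {F : B → ℂ}
    (hadd : ∀ x y, F (x + y) = F x + F y) (hsmul : ∀ (c : ℂ) x, F (c • x) = c * F x)
    (hF : ∀ x, ‖F x‖ ≤ ‖x‖) (h1 : F 1 = 1) {x : B} (hx : 0 ≤ x) : 0 ≤ F x := by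
  have him := im_apply_eq_zero_of_isSelfAdjoint hadd hsmul hF h1 (.of_nonneg hx)
  -- Contractivity on ‖x‖·1 - x gives ‖x‖ - Re F x ≤ ‖x‖.
  have hle : ‖((‖x‖ : ℝ) : ℂ) • (1 : B) + (-1 : ℂ) • x‖ ≤ ‖x‖ := by
    have hx' : x ≤ algebraMap ℝ B ‖x‖ := IsSelfAdjoint.le_algebraMap_norm_self (.of_nonneg hx)
    have e : ((‖x‖ : ℝ) : ℂ) • (1 : B) + (-1 : ℂ) • x = algebraMap ℝ B ‖x‖ - x := by
      rw [Algebra.algebraMap_eq_smul_one, Complex.coe_smul]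
      simp [sub_eq_add_neg]
    rw [e, CStarAlgebra.norm_le_iff_le_algebraMap _ (norm_nonneg _) (sub_nonneg.2 hx')]
    exact sub_le_self _ hx
  have h2 := (hF _).trans hle
  rw [hadd, hsmul, hsmul, h1] at h2
  have h3 := (Complex.re_le_norm _).trans h2
  simp at h3
  rw [Complex.nonneg_iff]
  exact ⟨h3, him.symm⟩

lemma norm_one_add_of_nonneg [Nontrivial B] {b : B} (hb : 0 ≤ b) : ‖1 + b‖ = 1 + ‖b‖ := by
  refine le_antisymm ((norm_add_le _ _).trans_eq (by rw [norm_one])) ?_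
  have h0 : (0 : B) ≤ 1 + b := add_nonneg zero_le_one hb
  have h1 : (1 : ℝ) ≤ ‖1 + b‖ := by
    rw [← norm_one (α := B)]
    exact CStarAlgebra.norm_le_norm_of_nonneg_of_le zero_le_one (le_add_of_nonneg_right hb)
  have h2 : 1 + b ≤ algebraMap ℝ B ‖1 + b‖ := IsSelfAdjoint.le_algebraMap_norm_self (.of_nonneg h0)
  have h3 : ‖b‖ ≤ ‖1 + b‖ - 1 := by
    rw [CStarAlgebra.norm_le_iff_le_algebraMap _ (by linarith) hb, map_sub, map_one]
    exact le_sub_iff_add_le'.2 h2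
  linarith

/-- Krein–Milman is applied with real scalars, so local convexity is needed over ℝ. -/
lemma WeakDual.locallyConvexSpace_real {E : Type*} [NormedAddCommGroup E] [NormedSpace ℂ E] :
    LocallyConvexSpace ℝ (WeakDual ℂ E) := by
  let f : WeakDual ℂ E →ₗ[ℝ] (E → ℂ) :=
    { toFun := fun F x => F x
      map_add' := fun F G => rfl
      map_smul' := fun r F => rfl }
  exact LocallyConvexSpace.induced f

/-- For each nonnegative `b` there is an extreme point `F` of the unit ball of the dual which is a
state and satisfies `F b = ‖b‖`. -/
lemma exists_extremePoint_state [Nontrivial B] {b : B} (hb : 0 ≤ b) :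
    ∃ F : WeakDual ℂ B, F ∈ (WeakDual.toStrongDual ⁻¹' Metric.closedBall (0 : StrongDual ℂ B) 1).extremePoints ℝ ∧
      (∀ x, ‖F x‖ ≤ ‖x‖) ∧ F 1 = 1 ∧ F b = ‖b‖ := by
  set K : Set (WeakDual ℂ B) := WeakDual.toStrongDual ⁻¹' Metric.closedBall (0 : StrongDual ℂ B) 1
  have hK : IsCompact K := WeakDual.isCompact_closedBall 0 1
  have memK : ∀ F : WeakDual ℂ B, F ∈ K ↔ ∀ x, ‖F x‖ ≤ ‖x‖ := by
    intro F
    simp only [K, Set.mem_preimage, mem_closedBall_zero_iff]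
    rw [ContinuousLinearMap.opNorm_le_iff zero_le_one]
    simp
  -- Since ‖1 + b‖ = 1 + ‖b‖, norming this single element forces both F 1 = 1 and F b = ‖b‖. The
  -- maximizers form a compact exposed face, whose extreme points are extreme in the ball.
  set c : B := 1 + b
  have hc : ‖c‖ = 1 + ‖b‖ := norm_one_add_of_nonneg hb
  have hc0 : ‖c‖ ≠ 0 := by rw [hc]; have := norm_nonneg b; positivity
  let l : WeakDual ℂ B →L[ℝ] ℝ :=
    { toFun := fun F => (F c).re
      map_add' := fun F G => Complex.add_re (F c) (G c)
      map_smul' := fun r F => Complex.re_ofReal_mul r (F c)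
      cont := Complex.continuous_re.comp (WeakDual.eval_continuous c) }
  have hexp := ContinuousLinearMap.toExposed.isExposed (l := l) (A := K)
  have hne : (l.toExposed K).Nonempty := by
    obtain ⟨G, hG, hGc⟩ := exists_dual_vector ℂ c hc0
    refine ⟨StrongDual.toWeakDual G, (memK _).2 fun x => ?_, fun F hF => ?_⟩
    · exact (G.le_opNorm x).trans_eq (by rw [hG, one_mul])
    · have : l (StrongDual.toWeakDual G) = ‖c‖ := by
        change (G c).re = _
        rw [hGc]; simp
      rw [this]
      exact (Complex.re_le_norm _).trans ((memK F).1 hF c)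
  have := WeakDual.locallyConvexSpace_real (E := B)
  obtain ⟨F, hF⟩ := (hexp.isCompact hK).extremePoints_nonempty hne
  have hFK : F ∈ K.extremePoints ℝ := hexp.isExtreme.extremePoints_subset_extremePoints hF
  have hFn := (memK F).1 hFK.1
  refine ⟨F, hFK, hFn, ?_⟩
  have hFc : (F c).re = ‖c‖ := by
    obtain ⟨G, hG, hGc⟩ := exists_dual_vector ℂ c hc0
    refine le_antisymm ((Complex.re_le_norm _).trans (hFn c)) ?_
    have := (extremePoints_subset hF).2 (StrongDual.toWeakDual G) ((memK _).2 fun x =>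
      (G.le_opNorm x).trans_eq (by rw [hG, one_mul]))
    have h2 : l (StrongDual.toWeakDual G) = ‖c‖ := by
      change (G c).re = _
      rw [hGc]; simp
    rw [h2] at this
    exact this
  have e : F c = F 1 + F b := map_add F 1 b
  have h1 := hFn 1
  have h2 := hFn b
  rw [norm_one] at h1
  rw [e, hc, Complex.add_re] at hFc
  have r1 := Complex.re_le_norm (F 1)
  have r2 := Complex.re_le_norm (F b)
  have aux : ∀ (z : ℂ) (r : ℝ), ‖z‖ ≤ r → z.re = r → z = r := by
    intro z r h h'
    have : ‖z‖ = z.re := le_antisymm (h.trans_eq h'.symm) (Complex.re_le_norm z)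
    have h0 : 0 ≤ z := Complex.re_eq_norm.1 this.symm
    rw [← h']
    exact Complex.ext rfl (by simpa using (Complex.nonneg_iff.1 h0).2.symm)
  exact ⟨by simpa using aux _ 1 h1 (by linarith), aux _ _ h2 (by linarith)⟩

end PureState

/-! ### Irreducible representations from extremal states. -/

section GNS

open scoped InnerProductSpace ComplexOrder

universe u

/-- The GNS representation of a state which is an extreme point of the unit ball of the dual is
irreducible; this gives norm-attaining irreducible representations of unital C⋆-algebras. -/
lemma exists_irreducible_unital {B : Type u} [CStarAlgebra B] [Nontrivial B] (a : B) :
    ∃ (H : Type u) (_ : NormedAddCommGroup H) (_ : InnerProductSpace ℂ H) (_ : CompleteSpace H)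
      (π : B →⋆ₐ[ℂ] (H →L[ℂ] H)), IsIrreducibleRep (π : B →⋆ₙₐ[ℂ] (H →L[ℂ] H)) ∧ ‖a‖ ≤ ‖π a‖ := by
  let _ := CStarAlgebra.spectralOrder B
  have _ := CStarAlgebra.spectralOrderedRing B
  obtain ⟨F, hext, hFn, hF1, hFa⟩ := exists_extremePoint_state (star_mul_self_nonneg a)
  have hpos : ∀ x : B, 0 ≤ x → 0 ≤ F x := fun x hx =>
    nonneg_apply_of_nonneg (map_add F) (map_smul F) hFn hF1 hx
  let f : B →ₚ[ℂ] ℂ := PositiveLinearMap.mk₀ (F : B →ₗ[ℂ] ℂ) hpos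
  have hf : ∀ x, f x = F x := fun x => rfl
  let π := f.gnsStarAlgHom
  let ζ : f.GNS := (f.toPreGNS 1 : f.PreGNS)
  have hπ : ∀ x, π x ζ = (f.toPreGNS x : f.PreGNS) := by
    intro x
    change f.gnsNonUnitalStarAlgHom x (f.toPreGNS 1 : f.PreGNS) = _
    rw [PositiveLinearMap.gnsNonUnitalStarAlgHom_apply_coe]
    simp
  have hin : ∀ x y, ⟪π x ζ, π y ζ⟫_ℂ = F (star x * y) := by
    intro x y
    rw [hπ, hπ, UniformSpace.Completion.inner_coe, PositiveLinearMap.preGNS_inner_def, ← hf]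
    simp
  have hdense : ∀ v : f.GNS, (∀ x, ⟪v, π x ζ⟫_ℂ = 0) → v = 0 := by
    intro v hv
    have : ∀ w : f.GNS, ⟪v, w⟫_ℂ = 0 := by
      intro w
      induction w using UniformSpace.Completion.induction_on with
      | hp => apply isClosed_eq <;> fun_prop
      | ih w => rw [← hv (f.ofPreGNS w), hπ]; rfl
    exact inner_self_eq_zero.1 (this v)
  have hζ : ⟪ζ, ζ⟫_ℂ = 1 := by
    have := hin 1 1
    simpa [hF1] using this
  have nsq : ∀ v : f.GNS, ⟪v, v⟫_ℂ = ((‖v‖ ^ 2 : ℝ) : ℂ) := fun v => by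
    rw [inner_self_eq_norm_sq_to_K]
    simp
  have hζn : ‖ζ‖ = 1 := by
    have := nsq ζ
    rw [hζ] at this
    have h2 : ‖ζ‖ ^ 2 = 1 := by exact_mod_cast this.symm
    nlinarith [norm_nonneg ζ]
  have hπn : ∀ x, ‖π x‖ ≤ ‖x‖ := fun x => NonUnitalStarAlgHom.norm_apply_le π x
  refine ⟨f.GNS, inferInstance, inferInstance, inferInstance, π, ?_, ?_⟩
  · intro K hKc hK
    replace hK : ∀ x, ∀ v ∈ K, π x v ∈ K := hK
    have : CompleteSpace K := hKc.completeSpace_coe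
    -- the projection commutes with the representation
    have hKo : ∀ x, ∀ v ∈ Kᗮ, π x v ∈ Kᗮ := by
      intro x v hv w hw
      have h1 : ⟪w, π x v⟫_ℂ = ⟪π (star x) w, v⟫_ℂ := by
        rw [map_star, ContinuousLinearMap.star_eq_adjoint, ContinuousLinearMap.adjoint_inner_left]
      rw [h1]
      exact hv _ (hK _ _ hw)
    let p : f.GNS := K.starProjection ζ
    let q : f.GNS := Kᗮ.starProjection ζ
    have hp : p ∈ K := Submodule.starProjection_apply_mem _ _
    have hq : q ∈ Kᗮ := Submodule.starProjection_apply_mem _ _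
    have hpq : p + q = ζ := K.starProjection_add_starProjection_orthogonal ζ
    have hkq : ∀ x, ⟪p, π x q⟫_ℂ = 0 := fun x => hKo x q hq p hp
    have hqk : ∀ x, ⟪q, π x p⟫_ℂ = 0 := fun x => by
      rw [← inner_conj_symm, hq _ (hK x p hp), map_zero]
    have hsum : ∀ x, F x = ⟪p, π x p⟫_ℂ + ⟪q, π x q⟫_ℂ := by
      intro x
      have h1 : F x = ⟪ζ, π x ζ⟫_ℂ := by simpa using (hin 1 x).symm
      rw [h1]
      conv_lhs => rw [← hpq, map_add, inner_add_left, inner_add_right, inner_add_right, hkq, hqk]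
      simp
    have hnorm : ‖p‖ ^ 2 + ‖q‖ ^ 2 = 1 := by
      have := hsum 1
      rw [hF1, map_one, one_apply_eq_self, one_apply_eq_self, nsq, nsq] at this
      exact_mod_cast this.symm
    by_cases hp0 : p = 0
    · left
      rw [eq_bot_iff]
      intro v hv
      refine hdense v fun x => ?_
      have : q = ζ := by rw [← hpq, hp0, zero_add]
      rw [← this]
      exact hKo x q hq v hv
    by_cases hq0 : q = 0
    · right
      have : p = ζ := by rw [← hpq, hq0, add_zero]
      rw [← Submodule.orthogonal_eq_bot_iff, eq_bot_iff]
      intro v hv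
      refine hdense v fun x => ?_
      rw [← this, ← inner_conj_symm, hv _ (hK x p hp), map_zero]
    -- F is now a proper convex combination of the vector states of p and q. Extremality makes p a
    -- multiple of ζ, so ζ ∈ K and q ∈ K ∩ Kᗮ.
    exfalso
    have hp' : 0 < ‖p‖ ^ 2 := by positivity
    have hq' : 0 < ‖q‖ ^ 2 := by positivity
    -- the vector functionals of the two components
    have mk : ∀ v : f.GNS, v ≠ 0 → ∃ G : WeakDual ℂ B,
        G ∈ (WeakDual.toStrongDual ⁻¹' Metric.closedBall (0 : StrongDual ℂ B) 1) ∧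
          ∀ x, G x = ((‖v‖ ^ 2 : ℝ) : ℂ)⁻¹ * ⟪v, π x v⟫_ℂ := by
      intro v hv
      have hv' : 0 < ‖v‖ ^ 2 := by positivity
      let l : B →ₗ[ℂ] ℂ :=
        { toFun := fun x => ((‖v‖ ^ 2 : ℝ) : ℂ)⁻¹ * ⟪v, π x v⟫_ℂ
          map_add' := fun x y => by
            rw [map_add, add_apply, inner_add_right, mul_add]
          map_smul' := fun c x => by
            rw [map_smul, smul_apply, inner_smul_right, RingHom.id_apply,
              smul_eq_mul]
            ring }
      have hl : ∀ x, ‖l x‖ ≤ 1 * ‖x‖ := by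
        intro x
        change ‖((‖v‖ ^ 2 : ℝ) : ℂ)⁻¹ * ⟪v, π x v⟫_ℂ‖ ≤ _
        rw [norm_mul, norm_inv, Complex.norm_real, Real.norm_of_nonneg hv'.le, one_mul,
          inv_mul_le_iff₀ hv']
        calc ‖⟪v, π x v⟫_ℂ‖ ≤ ‖v‖ * ‖π x v‖ := norm_inner_le_norm _ _
          _ ≤ ‖v‖ * (‖x‖ * ‖v‖) := by
            gcongr
            exact (ContinuousLinearMap.le_opNorm _ _).trans (by gcongr; exact hπn x)
          _ = _ := by ring
      refine ⟨StrongDual.toWeakDual (l.mkContinuous 1 hl), ?_, fun x => rfl⟩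
      rw [Set.mem_preimage, mem_closedBall_zero_iff]
      exact LinearMap.mkContinuous_norm_le l zero_le_one hl
    obtain ⟨G₁, hG₁, hG₁'⟩ := mk p hp0
    obtain ⟨G₂, hG₂, hG₂'⟩ := mk q hq0
    have hseg : F ∈ openSegment ℝ G₁ G₂ := by
      refine ⟨‖p‖ ^ 2, ‖q‖ ^ 2, hp', hq', hnorm, ?_⟩
      refine DFunLike.ext _ _ fun x => ?_
      change ((‖p‖ ^ 2 : ℝ) : ℂ) * G₁ x + ((‖q‖ ^ 2 : ℝ) : ℂ) * G₂ x = F x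
      rw [hG₁', hG₂', hsum, mul_inv_cancel_left₀, mul_inv_cancel_left₀]
      · exact_mod_cast hq'.ne'
      · exact_mod_cast hp'.ne'
    have hGF : G₁ = F := (mem_extremePoints.1 hext).2 G₁ hG₁ G₂ hG₂ hseg |>.1
    have hpz : p - ((‖p‖ ^ 2 : ℝ) : ℂ) • ζ = 0 := by
      refine hdense _ fun x => ?_
      have h1 : ⟪p, π x ζ⟫_ℂ = ⟪p, π x p⟫_ℂ := by
        rw [← hpq, map_add, inner_add_right, hkq, add_zero]
      have h2 : ⟪ζ, π x ζ⟫_ℂ = F x := by simpa using hin 1 x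
      rw [inner_sub_left, inner_smul_left, h1, h2, Complex.conj_ofReal, ← hGF, hG₁',
        mul_inv_cancel_left₀ (by exact_mod_cast hp'.ne'), sub_self]
    have hζK : ζ ∈ K := by
      have h3 : ((‖p‖ ^ 2 : ℝ) : ℂ) • ζ ∈ K := by rw [← sub_eq_zero.1 hpz]; exact hp
      exact (K.smul_mem_iff (by exact_mod_cast hp'.ne')).1 h3
    have hqK : q ∈ K := by
      rw [← add_sub_cancel_left p q, hpq]
      exact K.sub_mem hζK hp
    exact hq0 (inner_self_eq_zero.1 (hq q hqK))
  · have h1 : ‖a‖ ^ 2 = ‖π a ζ‖ ^ 2 := by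
      have := hin a a
      rw [nsq, hFa, CStarRing.norm_star_mul_self] at this
      rw [sq]
      exact_mod_cast this.symm
    have h2 : ‖a‖ = ‖π a ζ‖ := by
      rwa [sq_eq_sq₀ (norm_nonneg _) (norm_nonneg _)] at h1
    rw [h2]
    exact (ContinuousLinearMap.le_opNorm _ _).trans_eq (by rw [hζn, mul_one])

/-- Every element of a C⋆-algebra attains its norm in an irreducible representation. -/
lemma exists_irreducible_norm_le {A : Type u} [NonUnitalCStarAlgebra A] (a : A) :
    ∃ (H : Type u) (_ : NormedAddCommGroup H) (_ : InnerProductSpace ℂ H) (_ : CompleteSpace H)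
      (π : A →⋆ₙₐ[ℂ] (H →L[ℂ] H)), IsIrreducibleRep π ∧ ‖a‖ ≤ ‖π a‖ := by
  -- The unitization contains A isometrically, and its scalars preserve every subspace, so
  -- restricting to A keeps irreducibility.
  obtain ⟨H, i₁, i₂, i₃, π, hirr, hn⟩ := exists_irreducible_unital (a : Unitization ℂ A)
  refine ⟨H, i₁, i₂, i₃,
    (π : Unitization ℂ A →⋆ₙₐ[ℂ] (H →L[ℂ] H)).comp (Unitization.inrNonUnitalStarAlgHom ℂ A), ?_, ?_⟩
  · intro K hKc hK
    refine hirr K hKc fun x v hv => ?_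
    induction x with
    | inl_add_inr c x =>
      have : π (Unitization.inl c + (x : Unitization ℂ A)) v
          = c • v + π (x : Unitization ℂ A) v := by
        rw [map_add, add_apply, ← Unitization.algebraMap_eq_inl,
          AlgHomClass.commutes]
        rfl
      change π (Unitization.inl c + (x : Unitization ℂ A)) v ∈ K
      rw [this]
      exact K.add_mem (K.smul_mem _ hv) (hK x v hv)
  · rw [Unitization.norm_inr] at hn
    exact hn

end GNS

/-! ### Finite-dimensional representations: surjectivity and separation. -/

section FiniteDimensionalReps

open scoped InnerProductSpace
open ContinuousLinearMap InnerProductSpace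

universe u

variable {A : Type*} [NonUnitalCStarAlgebra A]
  {E F : Type*} [NormedAddCommGroup E] [InnerProductSpace ℂ E] [CompleteSpace E]
  [NormedAddCommGroup F] [InnerProductSpace ℂ F] [CompleteSpace F]

/-- The representation unitarily equivalent to `ρ` through `U`. -/
noncomputable def conjRep (U : E ≃ₗᵢ[ℂ] F) (ρ : A →⋆ₙₐ[ℂ] (E →L[ℂ] E)) : A →⋆ₙₐ[ℂ] (F →L[ℂ] F) :=
  NonUnitalStarAlgHom.comp
    (NonUnitalStarAlgHomClass.toNonUnitalStarAlgHom U.conjStarAlgEquiv : (E →L[ℂ] E) →⋆ₙₐ[ℂ] (F →L[ℂ] F)) ρ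

lemma conjRep_apply (U : E ≃ₗᵢ[ℂ] F) (ρ : A →⋆ₙₐ[ℂ] (E →L[ℂ] E)) (a : A) :
    conjRep U ρ a = U.conjStarAlgEquiv (ρ a) := rfl

lemma norm_conjStarAlgEquiv (U : E ≃ₗᵢ[ℂ] F) (T : E →L[ℂ] E) : ‖U.conjStarAlgEquiv T‖ = ‖T‖ :=
  NonUnitalStarAlgHom.norm_map U.conjStarAlgEquiv U.conjStarAlgEquiv.injective T

lemma norm_conjRep_apply (U : E ≃ₗᵢ[ℂ] F) (ρ : A →⋆ₙₐ[ℂ] (E →L[ℂ] E)) (a : A) :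
    ‖conjRep U ρ a‖ = ‖ρ a‖ := norm_conjStarAlgEquiv U _

/-- In an `n`-homogeneous C⋆-algebra every element attains its norm in an `n`-dimensional
representation. -/
lemma IsHomogeneousCStar.exists_norm_le {n : ℕ} {A : Type u} [NonUnitalCStarAlgebra A]
    (hA : IsHomogeneousCStar n A) [FiniteDimensional ℂ E] (hE : Module.finrank ℂ E = n) (a : A) :
    ∃ ρ : A →⋆ₙₐ[ℂ] (E →L[ℂ] E), ‖a‖ ≤ ‖ρ a‖ := by
  by_cases ha : a = 0
  · exact ⟨0, by simp [ha]⟩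
  obtain ⟨H, i₁, i₂, i₃, π, hirr, hn⟩ := exists_irreducible_norm_le a
  have hπ : π ≠ 0 := by
    rintro rfl
    rw [NonUnitalStarAlgHom.zero_apply, norm_zero] at hn
    exact ha (norm_le_zero_iff.1 hn)
  obtain ⟨hfd, hdim⟩ := hA H π hπ hirr
  let U : H ≃ₗᵢ[ℂ] E :=
    (stdOrthonormalBasis ℂ H).equiv (stdOrthonormalBasis ℂ E) (finCongr (hdim.trans hE.symm))
  exact ⟨conjRep U π, by rwa [norm_conjRep_apply]⟩

/-- The restriction of a representation to a closed invariant subspace. -/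
noncomputable def subRep (ρ : A →⋆ₙₐ[ℂ] (E →L[ℂ] E)) (K : Submodule ℂ E) [CompleteSpace K]
    (hK : ∀ a, ∀ v ∈ K, ρ a v ∈ K) : A →⋆ₙₐ[ℂ] (K →L[ℂ] K) where
  toFun a := K.orthogonalProjectionOnto ∘L ρ a ∘L K.subtypeL
  map_smul' c a := by ext; simp
  map_zero' := by ext; simp
  map_add' a b := by ext; simp
  map_mul' a b := by
    ext v
    have h1 : ((K.orthogonalProjectionOnto (ρ b v) : K) : E) = ρ b v :=
      Submodule.starProjection_eq_self_iff.2 (hK b v v.2)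
    simp [h1]
  map_star' a := by
    rw [star_eq_adjoint, adjoint_comp, adjoint_comp, Submodule.adjoint_subtypeL,
      Submodule.adjoint_orthogonalProjectionOnto, map_star, star_eq_adjoint, comp_assoc]

lemma coe_subRep_apply (ρ : A →⋆ₙₐ[ℂ] (E →L[ℂ] E)) (K : Submodule ℂ E) [CompleteSpace K]
    (hK : ∀ a, ∀ v ∈ K, ρ a v ∈ K) (a : A) (v : K) : (subRep ρ K hK a v : E) = ρ a v :=
  Submodule.starProjection_eq_self_iff.2 (hK a v v.2)

lemma apply_mem_orthogonal (ρ : A →⋆ₙₐ[ℂ] (E →L[ℂ] E)) {K : Submodule ℂ E}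
    (hK : ∀ a, ∀ v ∈ K, ρ a v ∈ K) (a : A) {v : E} (hv : v ∈ Kᗮ) : ρ a v ∈ Kᗮ := by
  intro w hw
  have h1 : ⟪w, ρ a v⟫_ℂ = ⟪ρ (star a) w, v⟫_ℂ := by
    rw [map_star, star_eq_adjoint, adjoint_inner_left]
  rw [h1]
  exact hv _ (hK _ _ hw)

lemma ne_zero_of_apply_apply_ne_zero {ρ : A →⋆ₙₐ[ℂ] (E →L[ℂ] E)} {a : A} {v : E}
    (h : ρ a v ≠ 0) : ρ ≠ 0 := by
  rintro rfl
  exact h rfl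

/-- A nonzero `n`-dimensional representation of an `n`-homogeneous C⋆-algebra is irreducible. -/
lemma IsHomogeneousCStar.isIrreducibleRep {n : ℕ} {A E : Type u} [NonUnitalCStarAlgebra A]
    [NormedAddCommGroup E] [InnerProductSpace ℂ E] [CompleteSpace E]
    (hA : IsHomogeneousCStar n A) [FiniteDimensional ℂ E] (hE : Module.finrank ℂ E = n)
    {ρ : A →⋆ₙₐ[ℂ] (E →L[ℂ] E)} (hρ : ρ ≠ 0) : IsIrreducibleRep ρ := by
  have hne : ∃ K : Submodule ℂ E, (∀ a, ∀ v ∈ K, ρ a v ∈ K) ∧ ∃ a, ∃ v ∈ K, ρ a v ≠ 0 := by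
    obtain ⟨a, ha⟩ := DFunLike.ne_iff.1 hρ
    obtain ⟨v, hv⟩ := DFunLike.ne_iff.1 ha
    exact ⟨⊤, fun _ _ _ => trivial, a, v, trivial, hv⟩
  -- Take K minimal among invariant subspaces with nonzero action. An invariant L ≤ K with zero
  -- action has a complement in K that still qualifies, so L = ⊥. Thus K is irreducible, of
  -- dimension n by homogeneity, hence everything.
  obtain ⟨K, ⟨hK, a, v, hv, hav⟩, hmin⟩ := exists_minimal_of_wellFoundedLT _ hne
  have key : ∀ L ≤ K, (∀ a, ∀ v ∈ L, ρ a v ∈ L) → L = ⊥ ∨ L = K := by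
    intro L hLK hL
    by_cases h : ∃ a, ∃ v ∈ L, ρ a v ≠ 0
    · exact Or.inr (le_antisymm hLK (hmin ⟨hL, h⟩ hLK))
    · left
      push Not at h
      have hmem : Lᗮ ⊓ K ∈ {K : Submodule ℂ E |
          (∀ a, ∀ v ∈ K, ρ a v ∈ K) ∧ ∃ a, ∃ v ∈ K, ρ a v ≠ 0} := by
        refine ⟨fun b w hw => ⟨apply_mem_orthogonal ρ hL b hw.1, hK b w hw.2⟩, a,
          v - L.starProjection v, ⟨L.sub_starProjection_mem_orthogonal v,
            K.sub_mem hv (hLK (L.starProjection_apply_mem v))⟩, ?_⟩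
        rwa [map_sub, h a _ (L.starProjection_apply_mem v), sub_zero]
      have hle : K ≤ Lᗮ ⊓ K := hmin hmem inf_le_right
      rw [eq_bot_iff]
      intro w hw
      exact inner_self_eq_zero.1 ((hle (hLK hw)).1 w hw)
  have hirr : IsIrreducibleRep (subRep ρ K hK) := by
    intro M _ hM
    have hle : M.map K.subtype ≤ K := Submodule.map_subtype_le K M
    have hinv : ∀ a, ∀ v ∈ M.map K.subtype, ρ a v ∈ M.map K.subtype := by
      rintro b _ ⟨w, hw, rfl⟩
      exact ⟨subRep ρ K hK b w, hM b w hw, coe_subRep_apply ρ K hK b w⟩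
    refine (key _ hle hinv).imp (fun h => ?_) fun h => ?_
    · exact by
        rw [eq_bot_iff]
        intro w hw
        have h1 : (w : E) ∈ M.map K.subtype := ⟨w, hw, rfl⟩
        rw [h] at h1
        exact Subtype.ext h1
    · rw [eq_top_iff]
      intro w _
      obtain ⟨x, hx, hxw⟩ := h.ge w.2
      rwa [← Subtype.ext hxw]
  have hK0 : subRep ρ K hK a ⟨v, hv⟩ ≠ 0 := by
    intro h
    refine hav ?_
    rw [← coe_subRep_apply ρ K hK a ⟨v, hv⟩, h]
    rfl
  have hKtop : K = ⊤ :=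
    Submodule.eq_top_of_finrank_eq ((hA K _ (ne_zero_of_apply_apply_ne_zero hK0) hirr).2.trans hE.symm)
  intro L _ hL
  rw [← hKtop]
  exact key L (hKtop ▸ le_top) hL

variable [FiniteDimensional ℂ E] [FiniteDimensional ℂ F]

omit [CompleteSpace E] in
/-- The algebra of operators on a finite-dimensional space is simple. -/
lemma mem_of_ideal (I : AddSubgroup (E →L[ℂ] E)) (hl : ∀ S, ∀ T ∈ I, S * T ∈ I)
    (hr : ∀ S, ∀ T ∈ I, T * S ∈ I) {S : E →L[ℂ] E} (hS : S ∈ I) (hS0 : S ≠ 0) (T : E →L[ℂ] E) :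
    T ∈ I := by
  obtain ⟨v, hv⟩ := DFunLike.ne_iff.1 hS0
  have hw : ⟪S v, S v⟫_ℂ ≠ 0 := inner_self_ne_zero.2 hv
  have h1 : ∀ x y : E, rankOne ℂ x y ∈ I := by
    intro x y
    have e : rankOne ℂ x y = (rankOne ℂ ((⟪S v, S v⟫_ℂ)⁻¹ • x) (S v) : E →L[ℂ] E) * (S * rankOne ℂ v y) := by
      ext z
      rw [mul_apply_eq_comp, mul_apply_eq_comp]
      rw [rankOne_apply, rankOne_apply, rankOne_apply, map_smul, inner_smul_right, smul_smul,
        mul_assoc, mul_inv_cancel₀ hw, mul_one]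
    rw [e]
    exact hl _ _ (hr _ _ hS)
  have h2 : (1 : E →L[ℂ] E) ∈ I := by
    have := (stdOrthonormalBasis ℂ E).sum_rankOne_eq_id
    rw [one_def, ← this]
    exact sum_mem fun i _ => h1 _ _
  simpa using hl T 1 h2

/-- A nonzero irreducible representation on a finite-dimensional space is surjective. -/
lemma IsIrreducibleRep.surjective {ρ : A →⋆ₙₐ[ℂ] (E →L[ℂ] E)} (hirr : IsIrreducibleRep ρ)
    (hρ : ρ ≠ 0) : Function.Surjective ρ := by
  -- Schur's lemma and Jacobson density need a unital ring. They show that the unitization maps onto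
  -- B(E); the image of A is then a nonzero ideal of B(E).
  let φ : Unitization ℂ A →ₐ[ℂ] (E →L[ℂ] E) := Unitization.lift ρ.toNonUnitalAlgHom
  have hφ : ∀ c (a : A) v, φ (Unitization.inl c + (a : Unitization ℂ A)) v = c • v + ρ a v := by
    intro c a v
    have h1 : φ (a : Unitization ℂ A) = ρ a := by simp [φ]
    rw [map_add, add_apply, ← Unitization.algebraMap_eq_inl, AlgHomClass.commutes, h1]
    rfl
  let S : Subalgebra ℂ (E →L[ℂ] E) := φ.range
  have : IsScalarTower ℂ S E := ⟨fun c T v => rfl⟩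
  have : Nontrivial E := by
    by_contra h
    rw [not_nontrivial_iff_subsingleton] at h
    exact hρ (by ext a v; exact Subsingleton.elim _ _)
  have hsimple : IsSimpleModule S E := by
    refine { toIsSimpleOrder := ?_ }
    have hnt : Nontrivial (Submodule S E) := (Submodule.nontrivial_iff S).2 this
    refine { exists_pair_ne := hnt.exists_pair_ne, eq_bot_or_eq_top := fun N => ?_ }
    have h := hirr (N.restrictScalars ℂ) (Submodule.closed_of_finiteDimensional _) fun a v hv => by
      have h1 : (⟨φ (a : Unitization ℂ A), ⟨_, rfl⟩⟩ : S) • v ∈ N := N.smul_mem _ hv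
      have h2 : (⟨φ (a : Unitization ℂ A), ⟨_, rfl⟩⟩ : S) • v = ρ a v := by
        change φ (a : Unitization ℂ A) v = ρ a v
        have := hφ 0 a v
        simpa using this
      rw [← h2]
      exact h1
    simpa using h
  have hdens : ∀ T : E →L[ℂ] E, ∃ u, φ u = T := by
    intro T
    let f : Module.End (Module.End S E) E :=
      { toFun := T
        map_add' := map_add T
        map_smul' := fun g v => by
          obtain ⟨c, rfl⟩ := (IsSimpleModule.algebraMap_end_bijective_of_isAlgClosed
            (A := S) (V := E) ℂ).2 g
          simp }
    let b := stdOrthonormalBasis ℂ E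
    classical
    obtain ⟨⟨_, u, rfl⟩, hr⟩ := jacobson_density (R := S) f (Finset.univ.image b)
    refine ⟨u, ?_⟩
    have : (φ u : E →ₗ[ℂ] E) = T := b.toBasis.ext fun i => by
      exact (hr (b i) (by simp)).symm
    exact ContinuousLinearMap.coe_injective this
  let I : AddSubgroup (E →L[ℂ] E) := (ρ : A →+ (E →L[ℂ] E)).range
  have hl : ∀ S, ∀ T ∈ I, S * T ∈ I := by
    rintro S _ ⟨a, rfl⟩
    obtain ⟨u, rfl⟩ := hdens S
    induction u with
    | inl_add_inr c x =>
      refine ⟨c • a + x * a, ?_⟩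
      ext v
      rw [mul_apply_eq_comp, hφ]
      simp
  have hr : ∀ S, ∀ T ∈ I, T * S ∈ I := by
    rintro S _ ⟨a, rfl⟩
    obtain ⟨u, rfl⟩ := hdens S
    induction u with
    | inl_add_inr c x =>
      refine ⟨c • a + a * x, ?_⟩
      ext v
      rw [mul_apply_eq_comp, hφ]
      simp
  obtain ⟨a, ha⟩ := DFunLike.ne_iff.1 hρ
  intro T
  exact mem_of_ideal I hl hr ⟨a, rfl⟩ ha T

/-- Inequivalent surjective representations are separated by an element. -/
lemma exists_apply_eq_zero_apply_eq_one {ρ : A →⋆ₙₐ[ℂ] (E →L[ℂ] E)} {π : A →⋆ₙₐ[ℂ] (F →L[ℂ] F)}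
    (hπ : Function.Surjective π) (hπ0 : π ≠ 0) (hρ : ρ ≠ 0 → Function.Surjective ρ)
    (hne : ∀ U : E ≃ₗᵢ[ℂ] F, conjRep U ρ ≠ π) : ∃ a, ρ a = 0 ∧ π a = 1 := by
  -- The image of ker ρ is an ideal, so it is zero or everything. If it is zero, π factors through ρ
  -- by an isomorphism of operator algebras, which a unitary implements.
  let J : AddSubgroup (F →L[ℂ] F) :=
    ((ρ : A →+ (E →L[ℂ] E)).ker).map (π : A →+ (F →L[ℂ] F))
  have hJ : ∀ T, T ∈ J ↔ ∃ a, ρ a = 0 ∧ π a = T := fun T => Iff.rfl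
  have hl : ∀ S, ∀ T ∈ J, S * T ∈ J := by
    rintro S T hT
    obtain ⟨a, ha, rfl⟩ := (hJ _).1 hT
    obtain ⟨b, rfl⟩ := hπ S
    exact (hJ _).2 ⟨b * a, by rw [map_mul, ha, mul_zero], map_mul _ _ _⟩
  have hr : ∀ S, ∀ T ∈ J, T * S ∈ J := by
    rintro S T hT
    obtain ⟨a, ha, rfl⟩ := (hJ _).1 hT
    obtain ⟨b, rfl⟩ := hπ S
    exact (hJ _).2 ⟨a * b, by rw [map_mul, ha, zero_mul], map_mul _ _ _⟩
  by_cases h : ∃ S ∈ J, S ≠ 0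
  · obtain ⟨S, hS, hS0⟩ := h
    exact (hJ _).1 (mem_of_ideal J hl hr hS hS0 1)
  exfalso
  push Not at h
  have hker : ∀ a, ρ a = 0 → π a = 0 := fun a ha => h _ ((hJ _).2 ⟨a, ha, rfl⟩)
  have hρ' : Function.Surjective ρ := by
    refine hρ fun h0 => hπ0 ?_
    ext1 a
    exact hker a (by rw [h0]; rfl)
  have heq : ∀ a b, ρ a = ρ b → π a = π b := fun a b hab => by
    rw [← sub_eq_zero, ← map_sub]
    exact hker _ (by rw [map_sub, hab, sub_self])
  let g := Function.surjInv hρ'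
  have hg : ∀ T, ρ (g T) = T := Function.surjInv_eq hρ'
  let θ : (E →L[ℂ] E) →⋆ₙₐ[ℂ] (F →L[ℂ] F) :=
    { toFun := fun T => π (g T)
      map_smul' := fun c T => by
        rw [← map_smul]
        exact heq _ _ (by simp [hg])
      map_zero' := hker _ (hg 0)
      map_add' := fun S T => by
        rw [← map_add]
        exact heq _ _ (by simp [hg])
      map_mul' := fun S T => by
        rw [← map_mul]
        exact heq _ _ (by simp [hg])
      map_star' := fun T => by
        rw [← map_star]
        exact heq _ _ (by rw [map_star, hg, hg]) }
  have hθ : ∀ a, θ (ρ a) = π a := fun a => heq _ _ (hg _)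
  have hsurj : Function.Surjective θ := fun T => by
    obtain ⟨a, rfl⟩ := hπ T
    exact ⟨ρ a, hθ a⟩
  have hinj : Function.Injective θ := by
    rw [injective_iff_map_eq_zero]
    intro T hT
    by_contra hT0
    have h1 : ∀ S, S ∈ (θ : (E →L[ℂ] E) →+ (F →L[ℂ] F)).ker :=
      mem_of_ideal _ (fun S T hT => by
        have hT' : θ T = 0 := hT
        change θ (S * T) = 0
        rw [map_mul, hT', mul_zero]) (fun S T hT => by
        have hT' : θ T = 0 := hT
        change θ (T * S) = 0
        rw [map_mul, hT', zero_mul]) hT hT0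
    refine hπ0 ?_
    ext1 a
    rw [← hθ]
    exact h1 (ρ a)
  let e := StarAlgEquiv.ofBijective θ ⟨hinj, hsurj⟩
  have hcont : Continuous e := NonUnitalStarAlgHom.isometry θ hinj |>.continuous
  obtain ⟨U, hU⟩ := StarAlgEquiv.eq_linearIsometryEquivConjStarAlgEquiv e hcont
  refine hne U ?_
  ext1 a
  rw [conjRep_apply, ← hU]
  exact hθ a

end FiniteDimensionalReps

/-! ### Spectral cutoffs. -/

section Calculus

variable {A : Type*} [NonUnitalCStarAlgebra A] {B : Type*} [CStarAlgebra B]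

lemma NonUnitalStarAlgHom.continuous_cstar (φ : A →⋆ₙₐ[ℂ] B) : Continuous φ :=
  AddMonoidHomClass.continuous_of_bound φ 1 fun x => by
    simpa using NonUnitalStarAlgHom.norm_apply_le φ x

/-- Elements built in A by non-unital calculus are evaluated under a representation by unital
calculus; f 0 = 0 makes the two agree. -/
lemma map_cfcₙ_eq_cfc (φ : A →⋆ₙₐ[ℂ] B) {f : ℝ → ℝ} (hf : Continuous f) (hf0 : f 0 = 0) {a : A}
    (ha : IsSelfAdjoint a) : φ (cfcₙ f a) = cfc f (φ a) := by
  rw [NonUnitalStarAlgHom.map_cfcₙ φ f a hf.continuousOn hf0 φ.continuous_cstar ha (ha.map φ),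
    cfcₙ_eq_cfc hf.continuousOn hf0]

lemma cfc_eq_zero_of_norm_lt {T : B} (hT : IsSelfAdjoint T) {r : ℝ} (h : ‖T‖ < r) {f : ℝ → ℝ}
    (hf : ∀ t ≤ r, f t = 0) : cfc f T = 0 := by
  have h1 : (spectrum ℝ T).EqOn f 0 := by
    intro t ht
    have := norm_apply_le_norm_cfc (id : ℝ → ℝ) T ht
    rw [cfc_id ℝ T] at this
    exact hf t ((le_abs_self t).trans (this.trans h.le))
  rw [cfc_congr h1, cfc_zero]

/-- As 3/16 = 1/4 · 3/4, the bound on t² - t keeps the spectrum out of the interval (1/4, 3/4), off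
which f takes only the values 0 and 1. -/
lemma isIdempotentElem_cfc {T : B} (hT : IsSelfAdjoint T) (h : ‖T * T - T‖ < 3 / 16) {f : ℝ → ℝ}
    (hf : Continuous f) (hf0 : ∀ t ≤ 1 / 4, f t = 0) (hf1 : ∀ t, 3 / 4 ≤ t → f t = 1) :
    IsIdempotentElem (cfc f T) := by
  rw [IsIdempotentElem, ← cfc_mul f f T hf.continuousOn hf.continuousOn]
  refine cfc_congr fun t ht => ?_
  have h1 : cfc (fun t : ℝ => t * t - t) T = T * T - T := by
    rw [cfc_sub (fun t : ℝ => t * t) (fun t => t) T, cfc_mul (fun t : ℝ => t) (fun t => t) T,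
      cfc_id' ℝ T]
  have h2 := norm_apply_le_norm_cfc (fun t : ℝ => t * t - t) T ht
  rw [h1, Real.norm_eq_abs] at h2
  have h3 := (abs_le.1 (h2.trans h.le)).1
  by_cases h4 : t ≤ 1 / 4
  · simp [hf0 t h4]
  · have h5 : 3 / 4 ≤ t := by nlinarith
    simp [hf1 t h5]

lemma cfc_eq_self_of_isIdempotentElem {P : B} (hP : IsSelfAdjoint P) (hP2 : IsIdempotentElem P)
    {f : ℝ → ℝ} (hf0 : f 0 = 0) (hf1 : f 1 = 1) : cfc f P = P := by
  have h1 : (spectrum ℝ P).EqOn f id := by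
    intro t ht
    have h2 := hP2.spectrum_subset ℝ ht
    simp only [Set.mem_insert_iff, Set.mem_singleton_iff] at h2
    rcases h2 with rfl | rfl
    · exact hf0
    · exact hf1
  rw [cfc_congr h1, cfc_id ℝ P]

lemma cfc_mul_self_eq_one {T : B} (hT : IsSelfAdjoint T) (h : ‖T - 1‖ < 1 / 2) {k : ℝ → ℝ}
    (hk : Continuous k) (hk1 : ∀ t, 1 / 2 ≤ t → k t * t = 1) : cfc k T * T = 1 := by
  have h1 : cfc k T * T = cfc (fun t => k t * t) T := by
    rw [cfc_mul k (fun t => t) T hk.continuousOn continuousOn_id, cfc_id' ℝ T]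
  rw [h1, ← cfc_one ℝ T]
  refine cfc_congr fun t ht => hk1 t ?_
  have h2 := norm_apply_le_norm_cfc (fun t : ℝ => t - 1) T ht
  rw [cfc_sub (fun t : ℝ => t) (fun _ => 1) T, cfc_id' ℝ T, cfc_const_one ℝ T, Real.norm_eq_abs] at h2
  have := (abs_le.1 (h2.trans h.le)).1
  linarith

end Calculus

/-! ### Compactness of the space of representations. -/

section Compactness

variable {A : Type*} [NonUnitalCStarAlgebra A]
  {E : Type*} [NormedAddCommGroup E] [InnerProductSpace ℂ E] [CompleteSpace E]

/-- The topology of pointwise norm convergence on representations. -/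
noncomputable instance repTopology : TopologicalSpace (A →⋆ₙₐ[ℂ] (E →L[ℂ] E)) :=
  .induced (fun ρ a => ρ a) inferInstance

lemma isInducing_rep : Topology.IsInducing fun (ρ : A →⋆ₙₐ[ℂ] (E →L[ℂ] E)) (a : A) => ρ a := ⟨rfl⟩

lemma continuous_rep_apply (a : A) : Continuous fun ρ : A →⋆ₙₐ[ℂ] (E →L[ℂ] E) => ρ a :=
  (continuous_apply a).comp isInducing_rep.continuous

lemma continuous_rep_iff {X : Type*} [TopologicalSpace X] {f : X → A →⋆ₙₐ[ℂ] (E →L[ℂ] E)} :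
    Continuous f ↔ ∀ a, Continuous fun x => f x a := by
  rw [isInducing_rep.continuous_iff, continuous_pi_iff]
  rfl

instance : T2Space (A →⋆ₙₐ[ℂ] (E →L[ℂ] E)) :=
  T2Space.of_injective_continuous (fun _ _ h => DFunLike.coe_injective h) isInducing_rep.continuous

lemma continuous_conjRep (U : E ≃ₗᵢ[ℂ] E) :
    Continuous (conjRep U : (A →⋆ₙₐ[ℂ] (E →L[ℂ] E)) → (A →⋆ₙₐ[ℂ] (E →L[ℂ] E))) := by
  rw [continuous_rep_iff]
  intro a
  have h : Continuous U.conjStarAlgEquiv :=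
    (NonUnitalStarAlgHom.isometry U.conjStarAlgEquiv U.conjStarAlgEquiv.injective).continuous
  exact h.comp (continuous_rep_apply a)

/-- Representations are contractive, so they form a closed subset of a product of compact balls.
Nondegeneracy is not a closed condition, which is why zero is included. -/
instance [FiniteDimensional ℂ E] : CompactSpace (A →⋆ₙₐ[ℂ] (E →L[ℂ] E)) := by
  rw [← isCompact_univ_iff, isInducing_rep.isCompact_iff, Set.image_univ]
  have hK : IsCompact (Set.univ.pi fun a : A => Metric.closedBall (0 : E →L[ℂ] E) ‖a‖) :=
    isCompact_univ_pi fun a => isCompact_closedBall _ _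
  have hc : ∀ a : A, Continuous fun f : A → E →L[ℂ] E => f a := continuous_apply
  have hC : IsClosed {f : A → E →L[ℂ] E | (∀ (c : ℂ) a, f (c • a) = c • f a) ∧
      (∀ a b, f (a + b) = f a + f b) ∧ (∀ a b, f (a * b) = f a * f b) ∧
      ∀ a, f (star a) = star (f a)} := by
    simp only [Set.ofPred_and, Set.ofPred_forall]
    refine .inter ?_ (.inter ?_ (.inter ?_ ?_))
    · exact isClosed_iInter fun c => isClosed_iInter fun a => isClosed_eq (hc _) ((hc a).const_smul c)
    · exact isClosed_iInter fun a => isClosed_iInter fun b => isClosed_eq (hc _) ((hc a).add (hc b))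
    · exact isClosed_iInter fun a => isClosed_iInter fun b => isClosed_eq (hc _) ((hc a).mul (hc b))
    · exact isClosed_iInter fun a => isClosed_eq (hc _) (hc a).star
  convert hK.inter_right hC using 1
  ext f
  constructor
  · rintro ⟨ρ, rfl⟩
    exact ⟨fun a _ => mem_closedBall_zero_iff.2 (NonUnitalStarAlgHom.norm_apply_le ρ a),
      map_smul ρ, map_add ρ, map_mul ρ, map_star ρ⟩
  · rintro ⟨-, h1, h2, h3, h4⟩
    exact ⟨{ toFun := f, map_smul' := h1, map_zero' := by simpa using h1 0 0, map_add' := h2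
             map_mul' := h3, map_star' := h4 }, rfl⟩

variable [FiniteDimensional ℂ E]

/-- A representation can be separated from a compact set of inequivalent ones by an element on which
they vanish. -/
lemma exists_vanishing_on_compact {C : Set (A →⋆ₙₐ[ℂ] (E →L[ℂ] E))} (hC : IsCompact C)
    (hsurj : ∀ ρ : A →⋆ₙₐ[ℂ] (E →L[ℂ] E), ρ ≠ 0 → Function.Surjective ρ)
    {π : A →⋆ₙₐ[ℂ] (E →L[ℂ] E)} (hπ : π ≠ 0) (hne : ∀ ρ ∈ C, ∀ U : E ≃ₗᵢ[ℂ] E, conjRep U ρ ≠ π) :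
    ∃ h : A, (∀ ρ ∈ C, ρ h = 0) ∧ π h = 1 := by
  -- Products glue: if h and h' vanish on two pieces, h * h' vanishes on their union and is still 1
  -- at π.
  refine hC.induction_on (p := fun s => ∃ h : A, (∀ ρ ∈ s, ρ h = 0) ∧ π h = 1) ?_ ?_ ?_ ?_
  · obtain ⟨h, hh⟩ := hsurj π hπ 1
    exact ⟨h, by simp, hh⟩
  · rintro s t hst ⟨h, h0, h1⟩
    exact ⟨h, fun ρ hρ => h0 ρ (hst hρ), h1⟩
  · rintro s t ⟨h, h0, h1⟩ ⟨h', h0', h1'⟩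
    refine ⟨h * h', fun ρ hρ => ?_, by rw [map_mul, h1, h1', mul_one]⟩
    rcases hρ with hρ | hρ
    · rw [map_mul, h0 ρ hρ, zero_mul]
    · rw [map_mul, h0' ρ hρ, mul_zero]
  · intro ρ hρ
    obtain ⟨a, ha0, ha1⟩ := exists_apply_eq_zero_apply_eq_one (hsurj π hπ) hπ (hsurj ρ) (hne ρ hρ)
    have hsa : IsSelfAdjoint (star a * a) := .star_mul_self a
    -- This upgrades vanishing at ρ to vanishing on the neighbourhood where ‖σ (a⋆a)‖ < 1/2, and
    -- fixes 1.
    let f : ℝ → ℝ := fun t => max 0 (2 * t - 1)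
    have hf : Continuous f := by fun_prop
    have hf0 : f 0 = 0 := by norm_num [f]
    refine ⟨{σ | ‖σ (star a * a)‖ < 1 / 2}, mem_nhdsWithin_of_mem_nhds ?_, cfcₙ f (star a * a), ?_, ?_⟩
    · refine (isOpen_lt (continuous_rep_apply _).norm continuous_const).mem_nhds ?_
      simp [map_mul, ha0]
    · intro σ hσ
      rw [map_cfcₙ_eq_cfc σ hf hf0 hsa]
      exact cfc_eq_zero_of_norm_lt (hsa.map σ) hσ fun t ht => max_eq_left (by linarith)
    · rw [map_cfcₙ_eq_cfc π hf hf0 hsa, map_mul, map_star, ha1, star_one, mul_one, cfc_apply_one]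
      norm_num [f]

end Compactness

/-! ### Extending representations. -/

section Extension

open scoped InnerProductSpace
open ContinuousLinearMap InnerProductSpace

universe u

lemma IsHomogeneousCStar.surjective {n : ℕ} {A : Type u} [NonUnitalCStarAlgebra A]
    {E : Type*} [NormedAddCommGroup E] [InnerProductSpace ℂ E] [CompleteSpace E]
    (hA : IsHomogeneousCStar n A) [FiniteDimensional ℂ E] (hE : Module.finrank ℂ E = n)
    (ρ : A →⋆ₙₐ[ℂ] (E →L[ℂ] E)) (hρ : ρ ≠ 0) : Function.Surjective ρ := by
  -- Homogeneity only speaks of Hilbert spaces in the universe of A, so ρ is moved to a copy there.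
  let F := EuclideanSpace ℂ (ULift.{u} (Fin n))
  have hF : Module.finrank ℂ F = n := by simp [F]
  let U : E ≃ₗᵢ[ℂ] F :=
    (stdOrthonormalBasis ℂ E).equiv (stdOrthonormalBasis ℂ F) (finCongr (hE.trans hF.symm))
  have hinj : Function.Injective U.conjStarAlgEquiv := EquivLike.injective _
  have h0 : conjRep U ρ ≠ 0 := by
    intro h
    refine hρ ?_
    ext1 a
    refine hinj ?_
    rw [← conjRep_apply, h, NonUnitalStarAlgHom.zero_apply, NonUnitalStarAlgHom.zero_apply, map_zero]
  intro T
  obtain ⟨a, ha⟩ := (hA.isIrreducibleRep hF h0).surjective h0 (U.conjStarAlgEquiv T)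
  exact ⟨a, hinj ha⟩

variable {A B : Type*} [NonUnitalCStarAlgebra A] [NonUnitalCStarAlgebra B]
  {E : Type*} [NormedAddCommGroup E] [InnerProductSpace ℂ E] [CompleteSpace E]

lemma continuous_rep_comp (ι : A →⋆ₙₐ[ℂ] B) :
    Continuous fun ρ : B →⋆ₙₐ[ℂ] (E →L[ℂ] E) => ρ.comp ι :=
  continuous_rep_iff.2 fun a => continuous_rep_apply (ι a)

variable [FiniteDimensional ℂ E]

/-- Representations extend along an injective ⋆-homomorphism. -/
lemma exists_rep_comp_eq {ι : A →⋆ₙₐ[ℂ] B} (hι : Function.Injective ι)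
    (hsurj : ∀ ρ : A →⋆ₙₐ[ℂ] (E →L[ℂ] E), ρ ≠ 0 → Function.Surjective ρ)
    (hB : ∀ b : B, ∃ ρ : B →⋆ₙₐ[ℂ] (E →L[ℂ] E), ‖b‖ ≤ ‖ρ b‖) (π : A →⋆ₙₐ[ℂ] (E →L[ℂ] E)) :
    ∃ ρ : B →⋆ₙₐ[ℂ] (E →L[ℂ] E), ρ.comp ι = π := by
  by_cases hπ : π = 0
  · exact ⟨0, hπ.symm⟩
  by_contra! hne
  obtain ⟨h, h0, h1⟩ := exists_vanishing_on_compact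
    (isCompact_range (continuous_rep_comp (E := E) ι)) hsurj hπ (by
      rintro _ ⟨ρ, rfl⟩ U
      exact hne (conjRep U ρ))
  obtain ⟨ρ, hρ⟩ := hB (ι h)
  have h2 : ρ (ι h) = 0 := h0 _ ⟨ρ, rfl⟩
  rw [h2, norm_zero] at hρ
  have h3 : h = 0 := hι ((norm_le_zero_iff.1 hρ).trans (map_zero ι).symm)
  refine hπ ?_
  ext1 a
  have h4 : (1 : E →L[ℂ] E) = 0 := by rw [← h1, h3, map_zero]
  rw [← one_mul (π a), h4, zero_mul]
  rfl

/-- Compressions by a rank one projection are scalar. -/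
lemma exists_compression_eq_smul {Q : E →L[ℂ] E} (hQ : IsSelfAdjoint Q) (hQ2 : IsIdempotentElem Q)
    (htr : ‖LinearMap.trace ℂ E Q - 1‖ < 1) :
    ∃ ξ : E, ∀ T : E →L[ℂ] E, Q * (star T * T) * Q = ((‖T ξ‖ ^ 2 : ℝ) : ℂ) • Q := by
  have hQ2' : IsIdempotentElem (Q : E →ₗ[ℂ] E) := hQ2.map ContinuousLinearMap.toLinearMapRingHom
  -- The trace of an idempotent is its rank, and the only integer at distance less than 1 from 1 is
  -- 1.
  have h1 : Module.finrank ℂ (LinearMap.range (Q : E →ₗ[ℂ] E)) = 1 := by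
    have h2 := LinearMap.IsProj.trace (LinearMap.IsIdempotentElem.isProj_range _ hQ2')
    rw [h2] at htr
    have h3 : |((Module.finrank ℂ (LinearMap.range (Q : E →ₗ[ℂ] E)) : ℤ) : ℝ) - 1| < 1 := by
      have : (((((Module.finrank ℂ (LinearMap.range (Q : E →ₗ[ℂ] E)) : ℤ) : ℝ) - 1 : ℝ)) : ℂ)
        = (Module.finrank ℂ (LinearMap.range (Q : E →ₗ[ℂ] E)) : ℂ) - 1 := by push_cast; rfl
      rwa [← this, Complex.norm_real, Real.norm_eq_abs] at htr
    have h4 : |(Module.finrank ℂ (LinearMap.range (Q : E →ₗ[ℂ] E)) : ℤ) - 1| < 1 := by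
      exact_mod_cast h3
    rw [Int.abs_lt_one_iff] at h4
    omega
  obtain ⟨⟨ζ, η, hη⟩, hζ0, hζ⟩ := finrank_eq_one_iff'.1 h1
  have hζ0' : ζ ≠ 0 := fun h => hζ0 (Subtype.ext h)
  have hη' : Q η = ζ := hη
  have hQζ : Q ζ = ζ := by rw [← hη', ← mul_apply_eq_comp, hQ2.eq]
  have hin : ⟪ζ, ζ⟫_ℂ ≠ 0 := inner_self_ne_zero.2 hζ0'
  have hQv : ∀ v, Q v = (⟪ζ, v⟫_ℂ / ⟪ζ, ζ⟫_ℂ) • ζ := by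
    intro v
    obtain ⟨c, hc⟩ := hζ ⟨Q v, v, rfl⟩
    have hc' : c • ζ = Q v := congrArg Subtype.val hc
    have h5 : ⟪ζ, v⟫_ℂ = c * ⟪ζ, ζ⟫_ℂ := by
      rw [← inner_smul_right, hc']
      conv_lhs => rw [← hQζ]
      conv_lhs => rw [← hQ.adjoint_eq, adjoint_inner_left]
    rw [h5, mul_div_cancel_right₀ _ hin, hc']
  refine ⟨((‖ζ‖⁻¹ : ℝ) : ℂ) • ζ, fun T => ?_⟩
  have hn : ‖ζ‖ ≠ 0 := norm_ne_zero_iff.2 hζ0'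
  have h6 : ((‖T (((‖ζ‖⁻¹ : ℝ) : ℂ) • ζ)‖ ^ 2 : ℝ) : ℂ) = ⟪ζ, star T (T ζ)⟫_ℂ / ⟪ζ, ζ⟫_ℂ := by
    rw [star_eq_adjoint, adjoint_inner_right, inner_self_eq_norm_sq_to_K,
      inner_self_eq_norm_sq_to_K, map_smul, norm_smul, Complex.norm_real, norm_inv, norm_norm]
    push_cast
    field_simp
    rfl
  ext v
  rw [h6, mul_apply_eq_comp, mul_apply_eq_comp, mul_apply_eq_comp, smul_apply]
  conv_lhs => rw [hQv v]
  rw [map_smul, map_smul, map_smul, hQv (star T (T ζ)), hQv v, smul_comm]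

end Extension

/-! ### Scalar bumps and the Stone–Weierstrass argument. -/

section Density

open scoped InnerProductSpace
open ContinuousLinearMap InnerProductSpace

variable {A B : Type*} [NonUnitalCStarAlgebra A] [NonUnitalCStarAlgebra B]
  {E : Type*} [NormedAddCommGroup E] [InnerProductSpace ℂ E] [CompleteSpace E]

/-- A continuous function vanishing at `0` which agrees with `t⁻¹` for `1 / 2 ≤ t`. -/
noncomputable def cutInv (t : ℝ) : ℝ := t / max (t ^ 2) (1 / 4)

lemma cutInv_zero : cutInv 0 = 0 := by simp [cutInv]

lemma cutInv_nonneg {t : ℝ} (ht : 0 ≤ t) : 0 ≤ cutInv t := by unfold cutInv; positivity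

lemma continuous_cutInv : Continuous cutInv :=
  continuous_id.div (by fun_prop) fun t => (lt_max_of_lt_right (by norm_num)).ne'

lemma cutInv_mul_le_one (t : ℝ) : cutInv t * t ≤ 1 := by
  have h : (0 : ℝ) < max (t ^ 2) (1 / 4) := lt_max_of_lt_right (by norm_num)
  rw [cutInv, div_mul_eq_mul_div, div_le_one h, ← sq]
  exact le_max_left _ _

lemma cutInv_mul_eq_one (t : ℝ) (ht : 1 / 2 ≤ t) : cutInv t * t = 1 := by
  rw [cutInv, max_eq_left (by nlinarith)]
  have : t ≠ 0 := by linarith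
  field_simp

variable [FiniteDimensional ℂ E]

/-- Elements acting as scalars in every representation, equal to `1` at a given representation and
supported near its unitary orbit. -/
lemma exists_scalar_bump
    (hsurj : ∀ ρ : A →⋆ₙₐ[ℂ] (E →L[ℂ] E), ρ ≠ 0 → Function.Surjective ρ)
    {π : A →⋆ₙₐ[ℂ] (E →L[ℂ] E)} (hπ : π ≠ 0) {N : Set (A →⋆ₙₐ[ℂ] (E →L[ℂ] E))} (hN : IsOpen N)
    (hπN : π ∈ N) :
    ∃ z : A, IsSelfAdjoint z ∧ π z = 1 ∧ ∀ ρ : A →⋆ₙₐ[ℂ] (E →L[ℂ] E),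
      ∃ t : ℝ, 0 ≤ t ∧ ρ z = (t : ℂ) • 1 ∧ (t ≠ 0 → ∃ U : E ≃ₗᵢ[ℂ] E, conjRep U ρ ∈ N) := by
  have hπs := hsurj π hπ
  have : Nontrivial E := by
    by_contra h
    rw [not_nontrivial_iff_subsingleton] at h
    exact hπ (by ext a v; exact Subsingleton.elim _ _)
  let b := stdOrthonormalBasis ℂ E
  obtain ⟨i₀⟩ : Nonempty (Fin (Module.finrank ℂ E)) := ⟨⟨0, Module.finrank_pos⟩⟩
  set P : E →L[ℂ] E := rankOne ℂ (b i₀) (b i₀) with hPdef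
  have hPsa : star P = P := by rw [star_eq_adjoint, hPdef, adjoint_rankOne]
  have hPid : IsIdempotentElem P := isIdempotentElem_rankOne_self (b.norm_eq_one i₀)
  obtain ⟨x, hx⟩ := hπs P
  -- Lifts of matrix units: they spread the rank one projection P over the basis, with ∑ vᵢ P vᵢ⋆ =
  -- 1 at π.
  choose v hv using fun i => hπs (rankOne ℂ (b i) (b i₀))
  let y := star x * x
  have hy : IsSelfAdjoint y := .star_mul_self x
  have hπy : π y = P := by rw [map_mul, map_star, hx, hPsa, hPid.eq]
  let f : ℝ → ℝ := fun t => max 0 (min 1 (2 * t - 1 / 2))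
  have hf : Continuous f := by fun_prop
  have hfl : ∀ t ≤ 1 / 4, f t = 0 := fun t ht =>
    max_eq_left ((min_le_right _ _).trans (by linarith))
  have hfr : ∀ t, 3 / 4 ≤ t → f t = 1 := fun t ht => by
    simp only [f]
    rw [min_eq_left (by linarith), max_eq_right zero_le_one]
  have hf0 : f 0 = 0 := hfl 0 (by norm_num)
  let e := cfcₙ f y
  have he : IsSelfAdjoint e := cfcₙ_predicate f y
  have hσe : ∀ σ : A →⋆ₙₐ[ℂ] (E →L[ℂ] E), σ e = cfc f (σ y) := fun σ =>
    map_cfcₙ_eq_cfc σ hf hf0 hy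
  have hπe : π e = P := by
    rw [hσe, hπy]
    exact cfc_eq_self_of_isIdempotentElem hPsa hPid hf0 (hfr 1 (by norm_num))
  let w := ∑ i, v i * e * star (v i)
  have hw : IsSelfAdjoint w := by
    refine isSelfAdjoint_sum _ fun i _ => ?_
    exact he.conjugate (v i)
  have hvP : ∀ i, π (v i) * P * star (π (v i)) = rankOne ℂ (b i) (b i) := by
    intro i
    rw [hv, star_eq_adjoint, adjoint_rankOne, hPdef]
    simp only [mul_def, rankOne_comp_rankOne, OrthonormalBasis.inner_eq_one, one_smul]
  have hsum : ∑ i, π (v i) * P * star (π (v i)) = 1 := by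
    rw [Finset.sum_congr rfl fun i _ => hvP i, b.sum_rankOne_eq_id]
    rfl
  have hπw : π w = 1 := by
    simp only [w, map_sum, map_mul, map_star, hπe]
    exact hsum
  let τ : (A →⋆ₙₐ[ℂ] (E →L[ℂ] E)) → ℂ := fun σ => LinearMap.trace ℂ E (σ e : E →ₗ[ℂ] E)
  have hτ : Continuous τ := by
    let l : (E →L[ℂ] E) →ₗ[ℂ] ℂ := LinearMap.trace ℂ E ∘ₗ ContinuousLinearMap.coeLM ℂ
    exact (LinearMap.continuous_of_finiteDimensional l).comp (continuous_rep_apply e)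
  -- Open conditions under which e stays a projection, has rank one, and w = ∑ vᵢ e vᵢ⋆ stays
  -- invertible.
  let N' : Set (A →⋆ₙₐ[ℂ] (E →L[ℂ] E)) :=
    N ∩ ({σ | ‖σ (y * y - y)‖ < 3 / 16} ∩ ({σ | ‖τ σ - 1‖ < 1} ∩ {σ | ‖σ w - 1‖ < 1 / 2}))
  have hN' : IsOpen N' :=
    hN.inter ((isOpen_lt (continuous_rep_apply _).norm continuous_const).inter
      ((isOpen_lt (hτ.sub continuous_const).norm continuous_const).inter
        (isOpen_lt ((continuous_rep_apply _).sub continuous_const).norm continuous_const)))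
  have hπN' : π ∈ N' := by
    refine ⟨hπN, ?_, ?_, ?_⟩
    · change ‖π (y * y - y)‖ < 3 / 16
      rw [map_sub, map_mul, hπy, hPid.eq, sub_self, norm_zero]
      norm_num
    · change ‖LinearMap.trace ℂ E (π e : E →ₗ[ℂ] E) - 1‖ < 1
      rw [hπe, hPdef, trace_rankOne, OrthonormalBasis.inner_eq_one, sub_self, norm_zero]
      norm_num
    · change ‖π w - 1‖ < 1 / 2
      rw [hπw, sub_self, norm_zero]
      norm_num
  let C : Set (A →⋆ₙₐ[ℂ] (E →L[ℂ] E)) := {ρ | ∀ U : E ≃ₗᵢ[ℂ] E, conjRep U ρ ∉ N'}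
  have hC : IsClosed C := by
    simp only [C, Set.ofPred_forall]
    exact isClosed_iInter fun U => (hN'.preimage (continuous_conjRep U)).isClosed_compl
  obtain ⟨h, hh0, hh1⟩ := exists_vanishing_on_compact hC.isCompact hsurj hπ
    fun ρ hρ U hU => hρ U (hU ▸ hπN')
  -- On N' the compression e h⋆h e is a scalar t times e, so m is t w, and `cutInv` of w cancels w.
  -- On C, h kills everything; outside C, a unitary moves ρ into N'.
  let m := ∑ i, v i * (e * (star h * h) * e) * star (v i)
  let z₀ := cfcₙ cutInv w * m
  have hσz : ∀ σ : A →⋆ₙₐ[ℂ] (E →L[ℂ] E), σ z₀ = cfc cutInv (σ w) *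
      ∑ i, σ (v i) * (σ e * (star (σ h) * σ h) * σ e) * star (σ (v i)) := by
    intro σ
    simp only [z₀, m, map_mul, map_sum, map_star,
      map_cfcₙ_eq_cfc σ continuous_cutInv cutInv_zero hw]
  have hgood : ∀ σ ∈ N', ∃ t : ℝ, 0 ≤ t ∧ σ z₀ = (t : ℂ) • 1 := by
    rintro σ ⟨-, h1, h2, h3⟩
    have hQ : IsIdempotentElem (σ e) := by
      rw [hσe]
      refine isIdempotentElem_cfc (hy.map σ) ?_ hf hfl hfr
      rw [← map_mul, ← map_sub]
      exact h1
    obtain ⟨ξ, hξ⟩ := exists_compression_eq_smul (he.map σ) hQ h2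
    refine ⟨‖σ h ξ‖ ^ 2, by positivity, ?_⟩
    have h4 : ∑ i, σ (v i) * σ e * star (σ (v i)) = σ w := by
      simp only [w, map_sum, map_mul, map_star]
    rw [hσz]
    simp only [hξ, mul_smul_comm, smul_mul_assoc]
    rw [← Finset.smul_sum, h4, mul_smul_comm,
      cfc_mul_self_eq_one (hw.map σ) h3 continuous_cutInv cutInv_mul_eq_one]
  have hall : ∀ ρ : A →⋆ₙₐ[ℂ] (E →L[ℂ] E),
      ∃ t : ℝ, 0 ≤ t ∧ ρ z₀ = (t : ℂ) • 1 ∧ (t ≠ 0 → ∃ U : E ≃ₗᵢ[ℂ] E, conjRep U ρ ∈ N) := by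
    intro ρ
    by_cases hρ : ρ ∈ C
    · refine ⟨0, le_rfl, ?_, fun h => absurd rfl h⟩
      rw [hσz, hh0 ρ hρ]
      simp
    · simp only [C, Set.mem_ofPred_eq, not_forall, not_not] at hρ
      obtain ⟨U, hU⟩ := hρ
      obtain ⟨t, ht, htz⟩ := hgood _ hU
      refine ⟨t, ht, EquivLike.injective U.conjStarAlgEquiv ?_, fun _ => ⟨U, hU.1⟩⟩
      rw [← conjRep_apply, htz, map_smul, map_one]
  have hπz : π z₀ = 1 := by
    rw [hσz, hπw, hπe, hh1, star_one, mul_one, mul_one, hPid.eq, hsum, mul_one, cfc_apply_one]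
    have := cutInv_mul_eq_one 1 (by norm_num)
    rw [mul_one] at this
    rw [this, map_one]
  refine ⟨star z₀ * z₀, .star_mul_self z₀, by rw [map_mul, map_star, hπz, star_one, mul_one],
    fun ρ => ?_⟩
  obtain ⟨t, ht, htz, htU⟩ := hall ρ
  refine ⟨t * t, by positivity, ?_, fun h => htU fun h0 => h (by rw [h0, zero_mul])⟩
  rw [map_mul, map_star, htz, star_smul, star_one, smul_mul_smul_comm, one_mul]
  simp

/-- If restriction of representations is injective, then the smaller algebra is dense. -/
lemma exists_norm_sub_le_of_restriction_injective {ι : A →⋆ₙₐ[ℂ] B}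
    (hsurj : ∀ ρ : A →⋆ₙₐ[ℂ] (E →L[ℂ] E), ρ ≠ 0 → Function.Surjective ρ)
    (hB : ∀ b : B, ∃ ρ : B →⋆ₙₐ[ℂ] (E →L[ℂ] E), ‖b‖ ≤ ‖ρ b‖)
    (hinj : Function.Injective fun ρ : B →⋆ₙₐ[ℂ] (E →L[ℂ] E) => ρ.comp ι) (a : B) {ε : ℝ}
    (hε : 0 < ε) : ∃ c : A, ‖a - ι c‖ ≤ ε := by
  have hK : IsCompact {ρ : B →⋆ₙₐ[ℂ] (E →L[ℂ] E) | ε ≤ ‖ρ a‖} :=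
    (isClosed_le continuous_const (continuous_rep_apply a).norm).isCompact
  -- An unnormalized partition of unity: s acts as a scalar t ≥ 0, c approximates t a within t ε,
  -- and t ≥ 1/2 on the piece. All of this is additive in (s, c).
  obtain ⟨s, c, hs, hsc⟩ := hK.induction_on
    (p := fun S => ∃ s c : A, IsSelfAdjoint s ∧ ∀ ρ : B →⋆ₙₐ[ℂ] (E →L[ℂ] E), ∃ t : ℝ, 0 ≤ t ∧
      ρ (ι s) = (t : ℂ) • 1 ∧ ‖ρ (ι c) - (t : ℂ) • ρ a‖ ≤ t * ε ∧ (ρ ∈ S → 1 / 2 ≤ t))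
    ⟨0, 0, .zero A, fun ρ => ⟨0, le_rfl, by simp, by simp, fun h => h.elim⟩⟩
    (by
      rintro S T hST ⟨s, c, hs, h⟩
      refine ⟨s, c, hs, fun ρ => ?_⟩
      obtain ⟨t, h0, h1, h2, h3⟩ := h ρ
      exact ⟨t, h0, h1, h2, fun hρ => h3 (hST hρ)⟩)
    (by
      rintro S T ⟨s, c, hs, h⟩ ⟨s', c', hs', h'⟩
      refine ⟨s + s', c + c', hs.add hs', fun ρ => ?_⟩
      obtain ⟨t, h0, h1, h2, h3⟩ := h ρ
      obtain ⟨t', h0', h1', h2', h3'⟩ := h' ρ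
      refine ⟨t + t', add_nonneg h0 h0', ?_, ?_, ?_⟩
      · rw [map_add, map_add, h1, h1', ← add_smul]
        push_cast
        rfl
      · have e : ρ (ι (c + c')) - ((t + t' : ℝ) : ℂ) • ρ a =
            (ρ (ι c) - (t : ℂ) • ρ a) + (ρ (ι c') - (t' : ℂ) • ρ a) := by
          rw [map_add, map_add]
          push_cast
          module
        rw [e, add_mul]
        exact (norm_add_le _ _).trans (add_le_add h2 h2')
      · rintro (hρ | hρ)
        · linarith [h3 hρ]
        · linarith [h3' hρ])
    (by
      intro ρ₀ hρ₀
      have hρ₀' : ε ≤ ‖ρ₀ a‖ := hρ₀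
      -- Injectivity at the zero representation is used here: only zero restricts to zero.
      have hne : ρ₀.comp ι ≠ 0 := by
        intro h
        have h0 : ρ₀ = 0 := hinj (h.trans rfl)
        rw [h0, NonUnitalStarAlgHom.zero_apply, norm_zero] at hρ₀'
        linarith
      have hnt : Nontrivial E := by
        by_contra h
        rw [not_nontrivial_iff_subsingleton] at h
        exact hne (by ext a v; exact Subsingleton.elim _ _)
      obtain ⟨b, hb⟩ := hsurj _ hne (ρ₀ a)
      let C : Set (B →⋆ₙₐ[ℂ] (E →L[ℂ] E)) := {ρ | ε ≤ ‖ρ (ι b) - ρ a‖}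
      have hC : IsCompact C := (isClosed_le continuous_const
        ((continuous_rep_apply (ι b)).sub (continuous_rep_apply a)).norm).isCompact
      -- The restrictions of representations where b is a bad approximation form a compact set,
      -- which misses that of ρ₀ by injectivity.
      have hN := (hC.image (continuous_rep_comp (E := E) ι)).isClosed.isOpen_compl
      obtain ⟨z, hz, hz1, hzρ⟩ := exists_scalar_bump hsurj hne hN (by
        rintro ⟨σ, hσ, hσρ⟩
        have h1 : σ = ρ₀ := hinj hσρ
        have h2 : ε ≤ ‖σ (ι b) - σ a‖ := hσ
        have h3 : ρ₀ (ι b) = ρ₀ a := hb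
        rw [h1, h3, sub_self, norm_zero] at h2
        linarith)
      refine ⟨{ρ | ‖ρ (ι z) - 1‖ < 1 / 2}, mem_nhdsWithin_of_mem_nhds ?_, z, z * b, hz,
        fun ρ => ?_⟩
      · refine (isOpen_lt ((continuous_rep_apply _).sub continuous_const).norm
          continuous_const).mem_nhds ?_
        have h3 : ρ₀ (ι z) = 1 := hz1
        change ‖ρ₀ (ι z) - 1‖ < 1 / 2
        rw [h3, sub_self, norm_zero]
        norm_num
      · obtain ⟨t, ht, htz, htU⟩ := hzρ (ρ.comp ι)
        have htz' : ρ (ι z) = (t : ℂ) • 1 := htz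
        refine ⟨t, ht, htz', ?_, fun hρ => ?_⟩
        · rw [map_mul, map_mul, htz', smul_mul_assoc, one_mul, ← smul_sub, norm_smul,
            Complex.norm_real, Real.norm_of_nonneg ht]
          rcases eq_or_ne t 0 with rfl | h0
          · simp
          · obtain ⟨U, hU⟩ := htU h0
            refine mul_le_mul_of_nonneg_left ?_ ht
            by_contra! hlt
            refine hU ⟨conjRep U ρ, ?_, rfl⟩
            change ε ≤ ‖conjRep U ρ (ι b) - conjRep U ρ a‖
            rw [← map_sub, norm_conjRep_apply, map_sub]
            exact hlt.le
        · have h4 : ‖ρ (ι z) - 1‖ < 1 / 2 := hρ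
          have h5 : (t : ℂ) • (1 : E →L[ℂ] E) - 1 = ((t - 1 : ℝ) : ℂ) • 1 := by
            push_cast
            module
          rw [htz', h5, norm_smul, norm_one, mul_one, Complex.norm_real, Real.norm_eq_abs] at h4
          linarith [(abs_lt.1 h4).1])
  -- Divide by t. With k = `cutInv t`, the error is at most (1 - k t)‖ρ a‖ + k t ε; the first term
  -- vanishes where ‖ρ a‖ ≥ ε and is at most (1 - k t) ε elsewhere.
  refine ⟨cfcₙ cutInv s * c, ?_⟩
  obtain ⟨ρ, hρ⟩ := hB (a - ι (cfcₙ cutInv s * c))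
  refine hρ.trans ?_
  obtain ⟨t, h0, h1, h2, h3⟩ := hsc ρ
  have h4 : ρ (ι (cfcₙ cutInv s)) = (cutInv t : ℂ) • 1 := by
    have h5 := map_cfcₙ_eq_cfc (ρ.comp ι) continuous_cutInv cutInv_zero hs
    have h6 : (ρ.comp ι) s = algebraMap ℝ (E →L[ℂ] E) t := by
      rw [Algebra.algebraMap_eq_smul_one, ← Complex.coe_smul]
      exact h1
    rw [h6, cfc_algebraMap, Algebra.algebraMap_eq_smul_one, ← Complex.coe_smul] at h5
    exact h5
  have h7 : ρ (a - ι (cfcₙ cutInv s * c)) = ((1 - cutInv t * t : ℝ) : ℂ) • ρ a -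
      (cutInv t : ℂ) • (ρ (ι c) - (t : ℂ) • ρ a) := by
    rw [map_sub, map_mul, map_mul, h4, smul_mul_assoc, one_mul]
    push_cast
    module
  have hk0 := cutInv_nonneg h0
  have hk1 := cutInv_mul_le_one t
  have h8 : (1 - cutInv t * t) * ‖ρ a‖ ≤ (1 - cutInv t * t) * ε := by
    by_cases hρK : ε ≤ ‖ρ a‖
    · rw [cutInv_mul_eq_one t (h3 hρK)]
      simp
    · exact mul_le_mul_of_nonneg_left (le_of_not_ge hρK) (by linarith)
  rw [h7]
  refine (norm_sub_le _ _).trans ?_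
  rw [norm_smul, norm_smul, Complex.norm_real, Complex.norm_real, Real.norm_of_nonneg hk0,
    Real.norm_of_nonneg (by linarith : 0 ≤ 1 - cutInv t * t)]
  have h9 := mul_le_mul_of_nonneg_left h2 hk0
  nlinarith

end Density

/-! ### Transfer to matrices. -/

theorem mainTheorem9 (n : ℕ) {A₂ : Type*} [NonUnitalCStarAlgebra A₂]
    (A₁ : NonUnitalStarSubalgebra ℂ A₂) [IsClosed (A₁ : Set A₂)]
    (h₁ : IsHomogeneousCStar n A₁) (h₂ : IsHomogeneousCStar n A₂) :
    (∀ π₁ : A₁ →⋆ₙₐ[ℂ] Matrix (Fin n) (Fin n) ℂ,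
      ∃ π₂ : A₂ →⋆ₙₐ[ℂ] Matrix (Fin n) (Fin n) ℂ, ∀ a : A₁, π₂ (a : A₂) = π₁ a) ∧
    ((∀ π₁ : A₁ →⋆ₙₐ[ℂ] Matrix (Fin n) (Fin n) ℂ,
      ∃! π₂ : A₂ →⋆ₙₐ[ℂ] Matrix (Fin n) (Fin n) ℂ, ∀ a : A₁, π₂ (a : A₂) = π₁ a) →
      A₁ = ⊤) := by
  let E := EuclideanSpace ℂ (Fin n)
  have hE : Module.finrank ℂ E = n := by simp [E]
  let ι : A₁ →⋆ₙₐ[ℂ] A₂ := NonUnitalStarSubalgebraClass.subtype A₁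
  let Φ : Matrix (Fin n) (Fin n) ℂ ≃⋆ₐ[ℂ] (E →L[ℂ] E) := Matrix.toEuclideanCLM
  let φ : Matrix (Fin n) (Fin n) ℂ →⋆ₙₐ[ℂ] (E →L[ℂ] E) :=
    NonUnitalStarAlgHomClass.toNonUnitalStarAlgHom Φ
  let ψ : (E →L[ℂ] E) →⋆ₙₐ[ℂ] Matrix (Fin n) (Fin n) ℂ :=
    NonUnitalStarAlgHomClass.toNonUnitalStarAlgHom Φ.symm
  have hψφ : ∀ M, ψ (φ M) = M := fun M => Φ.symm_apply_apply M
  have hψ : Function.Injective ψ := EquivLike.injective Φ.symm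
  have hs := h₁.surjective hE
  have hB := h₂.exists_norm_le hE
  refine ⟨fun π₁ => ?_, fun huniq => ?_⟩
  · obtain ⟨ρ, hρ⟩ := exists_rep_comp_eq (ι := ι) Subtype.val_injective hs hB (φ.comp π₁)
    refine ⟨ψ.comp ρ, fun a => ?_⟩
    have h : ρ (a : A₂) = φ (π₁ a) := DFunLike.congr_fun hρ a
    rw [NonUnitalStarAlgHom.comp_apply, h, hψφ]
  · have hinj : Function.Injective fun ρ : A₂ →⋆ₙₐ[ℂ] (E →L[ℂ] E) => ρ.comp ι := by
      intro ρ σ hρσ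
      have h := (huniq ((ψ.comp ρ).comp ι)).unique (y₁ := ψ.comp ρ) (y₂ := ψ.comp σ)
        (fun a => rfl) fun a => congrArg ψ (DFunLike.congr_fun hρσ a).symm
      ext1 a
      exact hψ (DFunLike.congr_fun h a)
    rw [eq_top_iff]
    intro a _
    have hcl : a ∈ closure (A₁ : Set A₂) := by
      rw [Metric.mem_closure_iff]
      intro ε hε
      obtain ⟨c, hc⟩ := exists_norm_sub_le_of_restriction_injective hs hB hinj a (half_pos hε)
      exact ⟨c, c.2, by rw [dist_eq_norm]; exact hc.trans_lt (half_lt_self hε)⟩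
    rwa [IsClosed.closure_eq ‹_›] at hcl
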